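/- Let $D\subseteq\mathbb R^2=\mathbb C$ be open and let $\nu: D\to\mathbb R$ be a $C^\infty$ function of $(x,y)\in D$ satisfying $$\nu>0,\qquad \nu_x\,\nu_y\neq 0\qquad\text{on } D,$$ and the natural partial differential equation of minimal surfaces $$\Delta\ln\nu+2\nu=0\qquad\text{on } D,$$ where $\Delta=\partial_x^2+\partial_y^2$. Then every point $(x_0,y_0)\in D$ has an open neighbourhood $U\subseteq D$ on which there is a holomorphic function $w=u+iv$ of $z=x+iy$ ($u,v$ real-valued) such that $$\nu(x,y)=\frac{4\,(u_x^2+u_y^2)}{(u^2+v^2+1)^2}\qquad\text{for all }(x,y)\in U.$$ -/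

import Mathlib

open scoped ContDiff

/-- The partial derivative `f_x` at `z = x + i y` of a real function of `(x, y)`,
the real plane being identified with `ℂ`. -/
noncomputable def partialX (f : ℂ → ℝ) (z : ℂ) : ℝ :=
  lineDeriv ℝ f z 1

/-- The partial derivative `f_y` at `z = x + i y` of a real function of `(x, y)`,
the real plane being identified with `ℂ`. -/
noncomputable def partialY (f : ℂ → ℝ) (z : ℂ) : ℝ :=
  lineDeriv ℝ f z Complex.I

/-- `ν` solves the natural partial differential equation of minimal surfaces,
`Δ ln ν + 2 ν = 0`, on `D`; the Laplacian is the one of the Euclidean plane `ℂ = ℝ²`. -/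
def SolvesNaturalPDE (D : Set ℂ) (ν : ℂ → ℝ) : Prop :=
  ∀ z ∈ D, Laplacian.laplacian (fun ζ : ℂ => Real.log (ν ζ)) z + 2 * ν z = 0

/-! This is Liouville's method. Put Φ = ln ν and f = exp(-Φ/2) = ν^(-1/2). The equation 4 Φ_zz̄ = -2
exp Φ makes q = (Φ_z²/2 - Φ_zz)/2 holomorphic, and f solves the linear equations f_zz = q f, f_z̄z̄
= q̄ f, with f f_zz̄ - |f_z|² = 1/4 (`exists_wirtinger_system_of_liouville`). Such an f is
determined by f, f_z, f_z̄, f_zz̄ at one point (`eq_zero_of_wirtinger_system`). If y, x are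
holomorphic solutions of η'' = q η, then |y|² + |x|² solves the same equations. The identity with
1/4 allows its data to be matched to those of f, with Wronskian 1/2, so f = |y|² + |x|²
(`exists_sum_norm_sq_representation`). For w = x/y this gives w' = 1/(2y²), hence 4|w'|²/(1+|w|²)² =
1/f² = ν, while |w'|² = u_x² + u_y². -/

open Metric Set Filter Topology Complex ComplexConjugate

/-! ### Linear holomorphic differential equations of second order -/

/-- Holomorphic functions on a disc have primitives vanishing at the centre, with a sup bound. -/
theorem exists_primitive_operator (c : ℂ) {r : ℝ} (hr : 0 < r) :
    ∃ P : (ℂ → ℂ) → ℂ → ℂ, ∀ f, DifferentiableOn ℂ f (ball c r) →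
      (∀ z ∈ ball c r, HasDerivAt (P f) (f z) z) ∧ P f c = 0 ∧
      ∀ C, (∀ z ∈ ball c r, ‖f z‖ ≤ C) → ∀ z ∈ ball c r, ‖P f z‖ ≤ C * r := by
  have key : ∀ f : ℂ → ℂ, ∃ g : ℂ → ℂ, DifferentiableOn ℂ f (ball c r) →
      (∀ z ∈ ball c r, HasDerivAt g (f z) z) ∧ g c = 0 ∧
      ∀ C, (∀ z ∈ ball c r, ‖f z‖ ≤ C) → ∀ z ∈ ball c r, ‖g z‖ ≤ C * r := by
    intro f
    by_cases hf : DifferentiableOn ℂ f (ball c r)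
    · obtain ⟨g, hg⟩ := hf.isExactOn_ball
      refine ⟨fun z => g z - g c, fun _ => ⟨fun z hz => (hg z hz).sub_const _, by simp, ?_⟩⟩
      intro C hC z hz
      have h1 := (convex_ball c r).norm_image_sub_le_of_norm_hasDerivWithin_le
        (fun x hx => (hg x hx).hasDerivWithinAt) hC (mem_ball_self hr) hz
      have h2 : ‖z - c‖ ≤ r := by rw [← dist_eq_norm]; exact (mem_ball.1 hz).le
      have h3 : 0 ≤ C := (norm_nonneg _).trans (hC z hz)
      exact h1.trans (mul_le_mul_of_nonneg_left h2 h3)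
    · exact ⟨0, fun h => absurd h hf⟩
  choose P hP using key
  exact ⟨P, hP⟩

/-- A dominated series whose terms are successive primitives may be differentiated termwise. -/
theorem hasDerivAt_tsum_of_shift {U : Set ℂ} (hU : IsOpen U) {F G : ℕ → ℂ → ℂ} {u : ℕ → ℝ}
    (hu : Summable u) (hF : ∀ n, ∀ z ∈ U, ‖F n z‖ ≤ u n)
    (h0 : ∀ z ∈ U, HasDerivAt (F 0) 0 z)
    (h1 : ∀ n, ∀ z ∈ U, HasDerivAt (F (n + 1)) (G n z) z) {z : ℂ} (hz : z ∈ U) :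
    HasDerivAt (fun z => ∑' n, F n z) (∑' n, G n z) z := by
  have hd : ∀ n, DifferentiableOn ℂ (F n) U := by
    rintro (_ | n) z hz
    · exact (h0 z hz).differentiableAt.differentiableWithinAt
    · exact (h1 n z hz).differentiableAt.differentiableWithinAt
  have h := hasSum_deriv_of_summable_norm hu hd hU hF hz
  have h' := (differentiableOn_tsum_of_summable_norm hu hd hU hF).differentiableAt
    (hU.mem_nhds hz) |>.hasDerivAt
  -- The term of index 0 has derivative 0; dropping it shifts the series of derivatives onto `G`.
  rw [← hasSum_nat_add_iff' 1] at h
  simp only [Finset.range_one, Finset.sum_singleton, (h0 z hz).deriv, sub_zero] at h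
  rw [show (fun n => deriv (F (n + 1)) z) = fun n => G n z from
    funext fun n => (h1 n z hz).deriv] at h
  rwa [h.tsum_eq]

/-- Local solvability of `y'' = q y` for holomorphic `q`, with prescribed initial values. -/
theorem exists_solution_linear_ode {q : ℂ → ℂ} {c : ℂ} {R : ℝ} (hR : 0 < R)
    (hq : DifferentiableOn ℂ q (ball c R)) :
    ∃ r > 0, r ≤ R ∧ ∃ M, (∀ z ∈ ball c r, ‖q z‖ ≤ M) ∧ ∀ a b : ℂ, ∃ y p : ℂ → ℂ, y c = a ∧ p c = b ∧
      ∀ z ∈ ball c r, HasDerivAt y (p z) z ∧ HasDerivAt p (q z * y z) z := by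
  obtain ⟨M, hM⟩ := (isCompact_closedBall c (R / 2)).exists_bound_of_continuousOn
    (hq.continuousOn.mono (closedBall_subset_ball (half_lt_self hR)))
  have hM0 : 0 ≤ M := (norm_nonneg _).trans (hM c (mem_closedBall_self (by positivity)))
  -- One integration costs a factor r. The bounds r ≤ 1/2 and M r ≤ 1/2 halve both components at
  -- each Picard step.
  obtain ⟨r, hr, hrR, hr1, hrM⟩ : ∃ r > 0, r ≤ R / 2 ∧ r ≤ 1 / 2 ∧ M * r ≤ 1 / 2 := by
    refine ⟨min (R / 2) (1 / (2 * (M + 1))), by positivity, min_le_left _ _, ?_, ?_⟩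
    · refine (min_le_right _ _).trans ?_
      rw [div_le_div_iff₀ (by positivity) (by norm_num)]; linarith
    · refine (mul_le_mul_of_nonneg_left (min_le_right _ _) hM0).trans ?_
      rw [mul_one_div, div_le_div_iff₀ (by positivity) (by norm_num)]; linarith
  have hsub : ball c r ⊆ closedBall c (R / 2) := ball_subset_closedBall.trans
    (closedBall_subset_closedBall hrR)
  have hqM : ∀ z ∈ ball c r, ‖q z‖ ≤ M := fun z hz => hM z (hsub hz)
  have hqr : DifferentiableOn ℂ q (ball c r) := hq.mono (ball_subset_ball (by linarith))
  refine ⟨r, hr, by linarith, M, hqM, fun a b => ?_⟩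
  obtain ⟨P, hP⟩ := exists_primitive_operator c hr
  -- `s n` is the n-th Picard increment for y' = p, p' = q y, not the n-th iterate; the solution is
  -- the sum of the increments. All but the constant `s 0` vanish at `c`.
  let s : ℕ → (ℂ → ℂ) × (ℂ → ℂ) := fun n => Nat.rec (fun _ => a, fun _ => b)
    (fun _ t => (P t.2, P (fun z => q z * t.1 z))) n
  have s0 : s 0 = (fun _ => a, fun _ => b) := rfl
  have s1 : ∀ n, s (n + 1) = (P (s n).2, P (fun z => q z * (s n).1 z)) := fun _ => rfl
  clear_value s
  set C := max ‖a‖ ‖b‖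
  have inv : ∀ n, DifferentiableOn ℂ (s n).1 (ball c r) ∧ DifferentiableOn ℂ (s n).2 (ball c r) ∧
      (∀ z ∈ ball c r, ‖(s n).1 z‖ ≤ C * (1 / 2) ^ n) ∧
      (∀ z ∈ ball c r, ‖(s n).2 z‖ ≤ C * (1 / 2) ^ n) := by
    intro n
    induction n with
    | zero =>
      simp only [s0, pow_zero, mul_one]
      exact ⟨differentiableOn_const _, differentiableOn_const _, fun _ _ => le_max_left _ _,
        fun _ _ => le_max_right _ _⟩
    | succ n ih =>
      obtain ⟨d1, d2, b1, b2⟩ := ih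
      have H1 := hP _ d2
      have H2 := hP _ (hqr.mul d1)
      have hC : 0 ≤ C * (1 / 2) ^ n := (norm_nonneg _).trans (b1 c (mem_ball_self hr))
      simp only [s1]
      refine ⟨fun z hz => (H1.1 z hz).differentiableAt.differentiableWithinAt,
        fun z hz => (H2.1 z hz).differentiableAt.differentiableWithinAt, fun z hz => ?_,
        fun z hz => ?_⟩
      · refine (H1.2.2 _ b2 z hz).trans ?_
        rw [pow_succ, ← mul_assoc]
        exact mul_le_mul_of_nonneg_left hr1 hC
      · refine (H2.2.2 (M * (C * (1 / 2) ^ n)) (fun z hz => ?_) z hz).trans ?_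
        · rw [Pi.mul_apply, norm_mul]
          exact mul_le_mul (hqM z hz) (b1 z hz) (norm_nonneg _) hM0
        · calc M * (C * (1 / 2) ^ n) * r = (C * (1 / 2) ^ n) * (M * r) := by ring
            _ ≤ (C * (1 / 2) ^ n) * (1 / 2) := mul_le_mul_of_nonneg_left hrM hC
            _ = _ := by ring
  have hu : Summable fun n : ℕ => C * (1 / 2 : ℝ) ^ n := summable_geometric_two.mul_left C
  refine ⟨fun z => ∑' n, (s n).1 z, fun z => ∑' n, (s n).2 z, ?_, ?_, fun z hz => ⟨?_, ?_⟩⟩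
  · dsimp only
    rw [tsum_eq_single 0, s0]
    rintro (_ | n) hn
    · exact absurd rfl hn
    · rw [s1]; exact (hP _ (inv n).2.1).2.1
  · dsimp only
    rw [tsum_eq_single 0, s0]
    rintro (_ | n) hn
    · exact absurd rfl hn
    · rw [s1]; exact (hP _ (hqr.mul (inv n).1)).2.1
  · refine hasDerivAt_tsum_of_shift isOpen_ball (F := fun n => (s n).1) (G := fun n => (s n).2)
      hu (fun n => (inv n).2.2.1) (fun z _ => ?_) (fun n z hz => ?_) hz
    · simpa only [s0] using hasDerivAt_const z a
    · simpa only [s1] using (hP _ (inv n).2.1).1 z hz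
  · rw [← tsum_mul_left]
    refine hasDerivAt_tsum_of_shift isOpen_ball (F := fun n => (s n).2)
      (G := fun n z => q z * (s n).1 z)
      hu (fun n => (inv n).2.2.2) (fun z _ => ?_) (fun n z hz => ?_) hz
    · simpa only [s0] using hasDerivAt_const z b
    · rw [s1]; exact (hP _ (hqr.mul (inv n).1)).1 z hz

/-! ### Calculus of Wirtinger derivatives -/

/-- The real-linear map `v ↦ a v + b v̄`. -/
noncomputable def wirtingerCLM (a b : ℂ) : ℂ →L[ℝ] ℂ :=
  a • (1 : ℂ →L[ℝ] ℂ) + b • (conjCLE : ℂ →L[ℝ] ℂ)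

@[simp]
theorem wirtingerCLM_apply (a b v : ℂ) : wirtingerCLM a b v = a * v + b * conj v := by
  simp [wirtingerCLM]

/-- `F` is real differentiable at `z` with `F_z = a` and `F_z̄ = b`. -/
def HasWirtingerAt (F : ℂ → ℂ) (a b z : ℂ) : Prop :=
  HasFDerivAt F (wirtingerCLM a b) z

namespace HasWirtingerAt

variable {F G : ℂ → ℂ} {a b c d z : ℂ}

theorem congr_deriv (h : HasWirtingerAt F a b z) (ha : a = c) (hb : b = d) :
    HasWirtingerAt F c d z := ha ▸ hb ▸ h

theorem add (hF : HasWirtingerAt F a b z) (hG : HasWirtingerAt G c d z) :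
    HasWirtingerAt (fun z => F z + G z) (a + c) (b + d) z := by
  unfold HasWirtingerAt at *
  refine (HasFDerivAt.fun_add hF hG).congr_fderiv ?_
  apply ContinuousLinearMap.ext; intro v; simp; ring

theorem sub (hF : HasWirtingerAt F a b z) (hG : HasWirtingerAt G c d z) :
    HasWirtingerAt (fun z => F z - G z) (a - c) (b - d) z := by
  unfold HasWirtingerAt at *
  refine (HasFDerivAt.fun_sub hF hG).congr_fderiv ?_
  apply ContinuousLinearMap.ext; intro v; simp; ring

theorem mul (hF : HasWirtingerAt F a b z) (hG : HasWirtingerAt G c d z) :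
    HasWirtingerAt (fun z => F z * G z) (a * G z + F z * c) (b * G z + F z * d) z := by
  unfold HasWirtingerAt at *
  refine (HasFDerivAt.fun_mul hF hG).congr_fderiv ?_
  apply ContinuousLinearMap.ext; intro v; simp; ring

theorem star (hF : HasWirtingerAt F a b z) :
    HasWirtingerAt (fun z => conj (F z)) (conj b) (conj a) z := by
  unfold HasWirtingerAt at *
  refine ((conjCLE : ℂ →L[ℝ] ℂ).hasFDerivAt.comp z hF).congr_fderiv ?_
  apply ContinuousLinearMap.ext; intro v; simp; ring

theorem _root_.HasDerivAt.hasWirtingerAt (hF : HasDerivAt F a z) : HasWirtingerAt F a 0 z := by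
  unfold HasWirtingerAt
  refine (hF.hasFDerivAt.restrictScalars ℝ).congr_fderiv ?_
  apply ContinuousLinearMap.ext; intro v; simp; ring

theorem hasDerivAt (hF : HasWirtingerAt F a 0 z) : HasDerivAt F a z := by
  have h : ContinuousLinearMap.restrictScalars ℝ (ContinuousLinearMap.toSpanSingleton ℂ a)
      = wirtingerCLM a 0 := by
    apply ContinuousLinearMap.ext; intro v; simp; ring
  simpa using (hasFDerivAt_of_restrictScalars ℝ hF h).hasDerivAt

theorem hasDerivAt_comp {g : ℂ → ℂ} {g' : ℂ} (hg : HasDerivAt g g' (F z))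
    (hF : HasWirtingerAt F a b z) : HasWirtingerAt (fun z => g (F z)) (g' * a) (g' * b) z := by
  unfold HasWirtingerAt at *
  refine ((hg.hasFDerivAt.restrictScalars ℝ).comp z hF).congr_fderiv ?_
  apply ContinuousLinearMap.ext; intro v; simp; ring

theorem congr_of_eventuallyEq (hF : HasWirtingerAt F a b z) (h : G =ᶠ[𝓝 z] F) :
    HasWirtingerAt G a b z :=
  HasFDerivAt.congr_of_eventuallyEq hF h

/-- The values of the differential at 1 and i give a + b and i(a - b), which determine a and b. -/
theorem unique (hF : HasWirtingerAt F a b z) (hG : HasWirtingerAt F c d z) : a = c ∧ b = d := by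
  have h := HasFDerivAt.unique hF hG
  have h1 := DFunLike.congr_fun h 1
  have h2 := DFunLike.congr_fun h I
  simp only [wirtingerCLM_apply, map_one, conj_I, mul_one] at h1 h2
  have h3 : a - b = c - d := by
    apply mul_right_cancel₀ I_ne_zero
    linear_combination h2
  constructor
  · linear_combination (h1 + h3) / 2
  · linear_combination (h1 - h3) / 2

theorem comp_line {z₀ ζ : ℂ} {t : ℝ} (hF : HasWirtingerAt F a b (z₀ + t * ζ)) :
    HasDerivAt (fun t : ℝ => F (z₀ + t * ζ)) (a * ζ + b * (starRingEnd ℂ) ζ) t := by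
  have h1 : HasDerivAt (fun t : ℝ => z₀ + t * ζ) ζ t := by
    simpa using ((hasDerivAt_id t).ofReal_comp.mul_const ζ).const_add z₀
  have := HasFDerivAt.comp_hasDerivAt (f := fun t : ℝ => z₀ + t * ζ) t (show HasFDerivAt F _ _ from hF) h1
  simpa using! this

end HasWirtingerAt

/-! ### Uniqueness for the linear system -/

/-- Uniqueness for the closed linear system satisfied by `h, h_z, h_z̄, h_zz̄`
when `h_zz = q h` and `h_z̄z̄ = q̄ h`. -/
theorem eq_zero_of_wirtinger_system {q h p s m : ℂ → ℂ} {c : ℂ} {r M : ℝ}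
    (hq : ∀ z ∈ ball c r, ‖q z‖ ≤ M)
    (hh : ∀ z ∈ ball c r, HasWirtingerAt h (p z) (s z) z)
    (hp : ∀ z ∈ ball c r, HasWirtingerAt p (q z * h z) (m z) z)
    (hs : ∀ z ∈ ball c r, HasWirtingerAt s (m z) (conj (q z) * h z) z)
    (hm : ∀ z ∈ ball c r, HasWirtingerAt m (q z * s z) (conj (q z) * p z) z)
    (h0 : h c = 0) (p0 : p c = 0) (s0 : s c = 0) (m0 : m c = 0) :
    ∀ z ∈ ball c r, h z = 0 := by
  intro z hz
  set ζ := z - c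
  have hseg : ∀ t ∈ Icc (0 : ℝ) 1, c + t * ζ ∈ ball c r := by
    intro t ht
    have hz' : ‖ζ‖ < r := by simpa [ζ, dist_eq_norm] using hz
    rw [mem_ball, dist_eq_norm, add_sub_cancel_left, norm_mul, norm_real, Real.norm_eq_abs,
      abs_of_nonneg ht.1]
    exact (mul_le_of_le_one_left (norm_nonneg _) ht.2).trans_lt hz'
  -- Along the segment from `c` to `z` the system is a linear ODE with zero initial value, so
  -- Grönwall's inequality applies.
  let V : ℝ → ℂ × ℂ × ℂ × ℂ := fun t =>
    (h (c + t * ζ), p (c + t * ζ), s (c + t * ζ), m (c + t * ζ))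
  let V' : ℝ → ℂ × ℂ × ℂ × ℂ := fun t => let x := c + t * ζ
    (p x * ζ + s x * conj ζ, q x * h x * ζ + m x * conj ζ, m x * ζ + conj (q x) * h x * conj ζ,
      q x * s x * ζ + conj (q x) * p x * conj ζ)
  have hV : ∀ t ∈ Icc (0 : ℝ) 1, HasDerivAt V (V' t) t := fun t ht =>
    (hh _ (hseg t ht)).comp_line.prodMk ((hp _ (hseg t ht)).comp_line.prodMk
      ((hs _ (hseg t ht)).comp_line.prodMk (hm _ (hseg t ht)).comp_line))
  have hM : 0 ≤ M := (norm_nonneg _).trans (hq z hz)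
  -- Each component of `V'` has the form α ζ + β ζ̄, where α and β are entries of `V` times 1, q or
  -- q̄. The factor M + 1 covers all three coefficients, and 2 counts the terms.
  have main := eq_zero_of_abs_deriv_le_mul_abs_self_of_eq_zero_right (f := V) (f' := V')
    (K := 2 * (M + 1) * ‖ζ‖) (a := 0) (b := 1)
    (fun t ht => (hV t ht).continuousAt.continuousWithinAt)
    (fun t ht => (hV t ⟨ht.1, ht.2.le⟩).hasDerivWithinAt)
    (by simp [V, h0, p0, s0, m0]) (fun t ht => ?_) 1 (by simp)
  · have := congrArg Prod.fst main
    simpa [V, ζ] using this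
  · have hx := hq _ (hseg t ⟨ht.1, ht.2.le⟩)
    simp only [V, V']
    generalize c + t * ζ = x at hx
    set N := ‖(h x, p x, s x, m x)‖
    have n1 : ‖h x‖ ≤ N := norm_fst_le (h x, p x, s x, m x)
    have n2' : ‖(p x, s x, m x)‖ ≤ N := norm_snd_le (h x, p x, s x, m x)
    have n2 : ‖p x‖ ≤ N := (norm_fst_le (p x, s x, m x)).trans n2'
    have n3' : ‖(s x, m x)‖ ≤ N := (norm_snd_le (p x, s x, m x)).trans n2'
    have n3 : ‖s x‖ ≤ N := (norm_fst_le (s x, m x)).trans n3'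
    have n4 : ‖m x‖ ≤ N := (norm_snd_le (s x, m x)).trans n3'
    have hN : 0 ≤ N := norm_nonneg _
    have one : ∀ α : ℂ, ‖α‖ ≤ N → ‖α‖ ≤ (M + 1) * N := fun α hα => by nlinarith
    have two : ∀ α β : ℂ, ‖α‖ ≤ N → ‖β‖ = ‖q x‖ → ‖β * α‖ ≤ (M + 1) * N := fun α β hα hβ => by
      rw [norm_mul, hβ]
      exact mul_le_mul (by linarith) hα (norm_nonneg _) (by linarith)
    have comb : ∀ α β : ℂ, ‖α‖ ≤ (M + 1) * N → ‖β‖ ≤ (M + 1) * N →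
        ‖α * ζ + β * conj ζ‖ ≤ 2 * (M + 1) * ‖ζ‖ * N := fun α β hα hβ => by
      refine (norm_add_le _ _).trans ?_
      rw [norm_mul, norm_mul, RCLike.norm_conj]
      nlinarith [mul_le_mul_of_nonneg_right hα (norm_nonneg ζ),
        mul_le_mul_of_nonneg_right hβ (norm_nonneg ζ)]
    have hc : ‖conj (q x)‖ = ‖q x‖ := RCLike.norm_conj _
    refine norm_prod_le_iff.2 ⟨comb _ _ (one _ n2) (one _ n3), norm_prod_le_iff.2
      ⟨comb _ _ (two _ _ n1 rfl) (one _ n4), norm_prod_le_iff.2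
      ⟨comb _ _ (one _ n4) (two _ _ n1 hc), comb _ _ (two _ _ n3 rfl) (two _ _ n2 hc)⟩⟩⟩

/-! ### Wirtinger derivatives of smooth functions and the Laplacian -/

/-- The Wirtinger derivative `∂F/∂z`. -/
noncomputable def dz (F : ℂ → ℂ) (z : ℂ) : ℂ := (fderiv ℝ F z 1 - I * fderiv ℝ F z I) / 2

/-- The Wirtinger derivative `∂F/∂z̄`. -/
noncomputable def dzbar (F : ℂ → ℂ) (z : ℂ) : ℂ := (fderiv ℝ F z 1 + I * fderiv ℝ F z I) / 2

theorem DifferentiableAt.hasWirtingerAt {F : ℂ → ℂ} {z : ℂ} (h : DifferentiableAt ℝ F z) :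
    HasWirtingerAt F (dz F z) (dzbar F z) z := by
  refine h.hasFDerivAt.congr_fderiv ?_
  apply ContinuousLinearMap.ext
  intro v
  have hF : fderiv ℝ F z v = v.re * fderiv ℝ F z 1 + v.im * fderiv ℝ F z I := by
    conv_lhs => rw [show v = v.re • (1 : ℂ) + v.im • I by simp]
    rw [map_add, map_smul, map_smul, real_smul, real_smul]
  have hc : conj v = v.re - v.im * I := by apply Complex.ext <;> simp
  rw [wirtingerCLM_apply, hF, dz, dzbar, hc]
  nth_rw 3 [← re_add_im v]
  linear_combination (v.im * fderiv ℝ F z I) * I_mul_I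

theorem ContDiffOn.fderiv_apply_const {F : ℂ → ℂ} {D : Set ℂ} (hD : IsOpen D)
    (h : ContDiffOn ℝ ∞ F D) (v : ℂ) : ContDiffOn ℝ ∞ (fun z => fderiv ℝ F z v) D :=
  (h.fderiv_of_isOpen hD (by simp)).clm_apply contDiffOn_const

theorem ContDiffOn.dz {F : ℂ → ℂ} {D : Set ℂ} (hD : IsOpen D) (h : ContDiffOn ℝ ∞ F D) :
    ContDiffOn ℝ ∞ (dz F) D :=
  ((h.fderiv_apply_const hD 1).sub (contDiffOn_const.mul (h.fderiv_apply_const hD I))).div_const 2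

theorem ContDiffOn.dzbar {F : ℂ → ℂ} {D : Set ℂ} (hD : IsOpen D) (h : ContDiffOn ℝ ∞ F D) :
    ContDiffOn ℝ ∞ (dzbar F) D :=
  ((h.fderiv_apply_const hD 1).add (contDiffOn_const.mul (h.fderiv_apply_const hD I))).div_const 2

theorem ContDiffOn.hasWirtingerAt {F : ℂ → ℂ} {D : Set ℂ} (hD : IsOpen D)
    (h : ContDiffOn ℝ ∞ F D) {z : ℂ} (hz : z ∈ D) :
    HasWirtingerAt F (_root_.dz F z) (_root_.dzbar F z) z :=
  ((h.differentiableOn (by simp)).differentiableAt (hD.mem_nhds hz)).hasWirtingerAt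

/-- `4 ∂_z̄ ∂_z = Δ = 4 ∂_z ∂_z̄`. -/
theorem ContDiffOn.dzbar_dz_eq_laplacian {F : ℂ → ℂ} {D : Set ℂ} (hD : IsOpen D)
    (h : ContDiffOn ℝ ∞ F D) {z : ℂ} (hz : z ∈ D) :
    _root_.dzbar (_root_.dz F) z = Laplacian.laplacian F z / 4 ∧
      _root_.dz (_root_.dzbar F) z = Laplacian.laplacian F z / 4 := by
  have hd : DifferentiableAt ℝ (fderiv ℝ F) z :=
    ((h.fderiv_of_isOpen hD (m := ∞) (by simp)).differentiableOn (by simp)).differentiableAt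
      (hD.mem_nhds hz)
  have hdv : ∀ v : ℂ, HasFDerivAt (fun x => fderiv ℝ F x v)
      ((fderiv ℝ (fderiv ℝ F) z).flip v) z := fun v =>
    (hd.hasFDerivAt.clm_apply (hasFDerivAt_const v z)).congr_fderiv (by apply ContinuousLinearMap.ext; simp)
  have hdz : HasFDerivAt (_root_.dz F) ((1 / 2 : ℂ) • ((fderiv ℝ (fderiv ℝ F) z).flip 1
      - I • (fderiv ℝ (fderiv ℝ F) z).flip I)) z := by
    refine (((hdv 1).sub ((hdv I).const_smul I)).const_smul (1 / 2 : ℂ)).congr_of_eventuallyEq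
      (.of_forall fun x => ?_)
    simp [_root_.dz]; ring
  have hdzb : HasFDerivAt (_root_.dzbar F) ((1 / 2 : ℂ) • ((fderiv ℝ (fderiv ℝ F) z).flip 1
      + I • (fderiv ℝ (fderiv ℝ F) z).flip I)) z := by
    refine (((hdv 1).add ((hdv I).const_smul I)).const_smul (1 / 2 : ℂ)).congr_of_eventuallyEq
      (.of_forall fun x => ?_)
    simp [_root_.dzbar]; ring
  have hsymm : fderiv ℝ (fderiv ℝ F) z I 1 = fderiv ℝ (fderiv ℝ F) z 1 I :=
    ((h.contDiffAt (hD.mem_nhds hz)).isSymmSndFDerivAt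
      (by simpa using (WithTop.coe_le_coe.2 le_top : ((2 : ℕ∞) : ℕ∞ω) ≤ ∞))) I 1
  rw [InnerProductSpace.laplacian_eq_iteratedFDeriv_complexPlane]
  simp only [iteratedFDeriv_two_apply]
  constructor
  · rw [_root_.dzbar, hdz.fderiv]
    simp [hsymm]
    linear_combination -(fderiv ℝ (fderiv ℝ F) z I I) / 4 * I_mul_I
  · rw [_root_.dz, hdzb.fderiv]
    simp [hsymm]
    linear_combination -(fderiv ℝ (fderiv ℝ F) z I I) / 4 * I_mul_I

/-! ### Linearisation of Liouville's equation -/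

/-- The closed first-order system satisfied by `f = exp (-Φ / 2)` when `Φ` is a smooth real
solution of `4 Φ_zz̄ + 2 exp Φ = 0`. Here `q = -(Φ_zz - Φ_z² / 2) / 2` is holomorphic. -/
theorem exists_wirtinger_system_of_liouville {D : Set ℂ} (hD : IsOpen D) {Φ : ℂ → ℂ}
    (hΦ : ContDiffOn ℝ ∞ Φ D) (hreal : ∀ z ∈ D, conj (Φ z) = Φ z)
    (hL : ∀ z ∈ D, Laplacian.laplacian Φ z = -2 * exp (Φ z)) :
    ∃ q p s m : ℂ → ℂ, DifferentiableOn ℂ q D ∧ ∀ z ∈ D,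
      s z = conj (p z) ∧
      m z * exp (-Φ z / 2) = p z * conj (p z) + 1 / 4 ∧
      HasWirtingerAt (fun z => exp (-Φ z / 2)) (p z) (s z) z ∧
      HasWirtingerAt p (q z * exp (-Φ z / 2)) (m z) z ∧
      HasWirtingerAt s (m z) (conj (q z) * exp (-Φ z / 2)) z ∧
      HasWirtingerAt m (q z * s z) (conj (q z) * p z) z := by
  set a := dz Φ
  set a₂ := dz a
  set f : ℂ → ℂ := fun z => exp (-Φ z / 2)
  have ha : ContDiffOn ℝ ∞ a D := hΦ.dz hD
  have ha₂ : ContDiffOn ℝ ∞ a₂ D := ha.dz hD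
  have ev : ∀ {z}, z ∈ D → ∀ᶠ x in 𝓝 z, x ∈ D := fun hz => hD.mem_nhds hz
  have wΦ : ∀ z ∈ D, HasWirtingerAt Φ (a z) (conj (a z)) z := fun z hz => by
    have h := hΦ.hasWirtingerAt hD hz
    have h' := h.star.congr_of_eventuallyEq ((ev hz).mono fun x hx => (hreal x hx).symm)
    rw [(h.unique h').2] at h
    exact h
  have wE : ∀ z ∈ D, HasWirtingerAt (fun z => exp (Φ z)) (exp (Φ z) * a z)
      (exp (Φ z) * conj (a z)) z := fun z hz => (wΦ z hz).hasDerivAt_comp (hasDerivAt_exp _)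
  have wf : ∀ z ∈ D, HasWirtingerAt f (-(f z * a z) / 2) (-(f z * conj (a z)) / 2) z :=
    fun z hz => ((wΦ z hz).hasDerivAt_comp (g := fun w => exp (-w / 2))
      (((hasDerivAt_id _).neg.div_const 2).cexp)).congr_deriv
        (by simp only [f]; ring) (by simp only [f]; ring)
  have hb : ∀ z ∈ D, dzbar a z = -exp (Φ z) / 2 := fun z hz => by
    rw [(hΦ.dzbar_dz_eq_laplacian hD hz).1, hL z hz]; ring
  have wa : ∀ z ∈ D, HasWirtingerAt a (a₂ z) (-exp (Φ z) / 2) z := fun z hz =>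
    (ha.hasWirtingerAt hD hz).congr_deriv rfl (hb z hz)
  have hE : ∀ z ∈ D, conj (exp (Φ z)) = exp (Φ z) := fun z hz => by
    rw [← exp_conj, hreal z hz]
  have hf : ∀ z ∈ D, conj (f z) = f z := fun z hz => by
    simp only [f]; rw [← exp_conj]; simp [hreal z hz, map_ofNat]
  have hfE : ∀ z, f z ^ 2 * exp (Φ z) = 1 := fun z => by
    simp only [f]
    rw [← exp_nat_mul, ← exp_add, exp_eq_one_iff]
    exact ⟨0, by push_cast; ring⟩
  have wa' : ∀ z ∈ D, HasWirtingerAt (fun z => conj (a z)) (-exp (Φ z) / 2) (conj (a₂ z)) z :=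
    fun z hz => (wa z hz).star.congr_deriv (by simp [hE z hz, map_ofNat]) rfl
  -- Both mixed derivatives of `a` are a quarter of its Laplacian, so Φ_zzz̄ is the z-derivative of
  -- Φ_zz̄ = -exp Φ / 2.
  have wa₂ : ∀ z ∈ D, HasWirtingerAt a₂ (dz a₂ z) (-(exp (Φ z) * a z) / 2) z := fun z hz => by
    refine (ha₂.hasWirtingerAt hD hz).congr_deriv rfl ?_
    rw [(ha.dzbar_dz_eq_laplacian hD hz).1, ← (ha.dzbar_dz_eq_laplacian hD hz).2]
    have h1 := ((ha.dzbar hD).hasWirtingerAt hD hz)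
    have h2 := ((wE z hz).hasDerivAt_comp (g := fun w => -w / 2)
      ((hasDerivAt_id _).neg.div_const 2)).congr_of_eventuallyEq ((ev hz).mono hb)
    rw [(h1.unique h2).1]; ring
  set q : ℂ → ℂ := fun z => (a z * a z * (1 / 2) - a₂ z) * (1 / 2)
  have wc : ∀ (k z : ℂ), HasWirtingerAt (fun _ => k) 0 0 z := fun k z =>
    (hasDerivAt_const z k).hasWirtingerAt
  refine ⟨q, fun z => f z * a z * (-1 / 2), fun z => f z * conj (a z) * (-1 / 2),
    fun z => f z * (a z * conj (a z) + exp (Φ z)) * (1 / 4), fun z hz => ?_, fun z hz =>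
    ⟨?_, ?_, (wf z hz).congr_deriv (by ring) (by ring), ?_, ?_, ?_⟩⟩
  -- q_z̄ = 0: the contributions of Φ_z²/2 and Φ_zz are both -exp(Φ) Φ_z / 2 and cancel.
  · have h := ((((wa z hz).mul (wa z hz)).mul (wc (1 / 2) z)).sub (wa₂ z hz)).mul (wc (1 / 2) z)
    exact (h.congr_deriv rfl (d := 0) (by ring)).hasDerivAt.differentiableAt.differentiableWithinAt
  · simp [hf z hz, map_ofNat]
  · simp only [map_mul, hf z hz, map_div₀, map_neg, map_one, map_ofNat]
    linear_combination hfE z / 4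
  · exact (((wf z hz).mul (wa z hz)).mul (wc _ z)).congr_deriv (by simp only [q, f]; ring) (by ring)
  · exact (((wf z hz).mul (wa' z hz)).mul (wc _ z)).congr_deriv (by ring)
      (by simp only [q, map_mul, map_sub, map_div₀, map_one, map_ofNat]; simp only [f]; ring)
  · exact (((wf z hz).mul (((wa z hz).mul (wa' z hz)).add (wE z hz))).mul (wc _ z)).congr_deriv
      (by simp only [q]; ring)
      (by simp only [q, map_mul, map_sub, map_div₀, map_one, map_ofNat]; ring)

/-! ### Representation as a sum of two squared moduli -/

/-- Local representation of a solution of the system as `|η₁|² + |η₂|²`, with `η₁, η₂`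
holomorphic of Wronskian `1 / 2`. -/
theorem exists_sum_norm_sq_representation {D : Set ℂ} (hD : IsOpen D) {q f p s m : ℂ → ℂ}
    (hq : DifferentiableOn ℂ q D)
    (hf : ∀ z ∈ D, HasWirtingerAt f (p z) (s z) z)
    (hp : ∀ z ∈ D, HasWirtingerAt p (q z * f z) (m z) z)
    (hs : ∀ z ∈ D, HasWirtingerAt s (m z) (conj (q z) * f z) z)
    (hm : ∀ z ∈ D, HasWirtingerAt m (q z * s z) (conj (q z) * p z) z)
    {c : ℂ} (hc : c ∈ D) {ρ : ℝ} (hρ : 0 < ρ) (hfρ : f c = ((ρ ^ 2 : ℝ) : ℂ))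
    (hsp : s c = conj (p c)) (hdet : m c * f c = p c * conj (p c) + 1 / 4) :
    ∃ r > 0, ball c r ⊆ D ∧ ∃ η₁ η₂ η₁' η₂' : ℂ → ℂ, η₁ c ≠ 0 ∧
      ∀ z ∈ ball c r, HasDerivAt η₁ (η₁' z) z ∧ HasDerivAt η₂ (η₂' z) z ∧
        η₁ z * η₂' z - η₂ z * η₁' z = 1 / 2 ∧
        f z = η₁ z * conj (η₁ z) + η₂ z * conj (η₂ z) := by
  obtain ⟨R, hR, hRD⟩ := Metric.isOpen_iff.1 hD c hc
  obtain ⟨r, hr, hrR, M, hM, hode⟩ := exists_solution_linear_ode hR (hq.mono hRD)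
  have hrD : ball c r ⊆ D := (ball_subset_ball hrR).trans hRD
  have hρ0 : (ρ : ℂ) ≠ 0 := by exact_mod_cast hρ.ne'
  -- With x(c) = 0, matching f(c) = ρ² and f_z(c) forces y'(c) = p(c)/ρ for y(c) = ρ. Then |x'(c)|²
  -- must be m(c) - |p(c)|²/ρ², which `hdet` evaluates to 1/(4ρ²).
  obtain ⟨y, y', y0, y0', hy⟩ := hode ρ (p c / ρ)
  obtain ⟨x, x', x0, x0', hx⟩ := hode 0 (1 / (2 * ρ))
  have hcr : c ∈ ball c r := mem_ball_self hr
  have hW : ∀ z ∈ ball c r, y z * x' z - x z * y' z = 1 / 2 := by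
    have hd : ∀ z ∈ ball c r, HasDerivAt (fun z => y z * x' z - x z * y' z) 0 z := fun z hz => by
      refine (((hy z hz).1.mul (hx z hz).2).sub ((hx z hz).1.mul (hy z hz).2)).congr_deriv ?_
      ring
    intro z hz
    have h := (convex_ball c r).norm_image_sub_le_of_norm_hasDerivWithin_le (C := 0)
      (fun x hx => (hd x hx).hasDerivWithinAt) (fun _ _ => by simp) hcr hz
    rw [zero_mul, norm_le_zero_iff, sub_eq_zero] at h
    rw [h, y0, x0, x0']
    field_simp
    ring
  have wy := fun z hz => (hy z hz).1.hasWirtingerAt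
  have wy' := fun z hz => (hy z hz).2.hasWirtingerAt
  have wx := fun z hz => (hx z hz).1.hasWirtingerAt
  have wx' := fun z hz => (hx z hz).2.hasWirtingerAt
  -- By linearity, f minus the sum of squares and its three derivatives satisfy the same system,
  -- with zero data at `c`.
  refine ⟨r, hr, hrD, y, x, y', x', by rwa [y0], fun z hz => ⟨(hy z hz).1, (hx z hz).1, hW z hz,
    sub_eq_zero.1 (eq_zero_of_wirtinger_system hM
      (h := fun z => f z - (y z * conj (y z) + x z * conj (x z)))
      (p := fun z => p z - (y' z * conj (y z) + x' z * conj (x z)))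
      (s := fun z => s z - (y z * conj (y' z) + x z * conj (x' z)))
      (m := fun z => m z - (y' z * conj (y' z) + x' z * conj (x' z)))
      (fun z hz => ?_) (fun z hz => ?_) (fun z hz => ?_) (fun z hz => ?_) ?_ ?_ ?_ ?_ z hz)⟩⟩
  · exact ((hf z (hrD hz)).sub (((wy z hz).mul (wy z hz).star).add
      ((wx z hz).mul (wx z hz).star))).congr_deriv (by simp) (by simp)
  · exact ((hp z (hrD hz)).sub (((wy' z hz).mul (wy z hz).star).add
      ((wx' z hz).mul (wx z hz).star))).congr_deriv (by simp; ring) (by simp)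
  · exact ((hs z (hrD hz)).sub (((wy z hz).mul (wy' z hz).star).add
      ((wx z hz).mul (wx' z hz).star))).congr_deriv (by simp) (by simp; ring)
  · exact ((hm z (hrD hz)).sub (((wy' z hz).mul (wy' z hz).star).add
      ((wx' z hz).mul (wx' z hz).star))).congr_deriv (by simp; ring) (by simp; ring)
  · simp [y0, x0, hfρ]; ring
  · simp only [y0, x0, y0', x0', conj_ofReal, map_zero]; field_simp; ring
  · simp only [y0, x0, y0', x0', conj_ofReal, map_div₀, hsp]; field_simp; ring
  · have hfρ' : f c = (ρ : ℂ) ^ 2 := by rw [hfρ]; push_cast; rfl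
    rw [hfρ'] at hdet
    simp only [y0', x0', conj_ofReal, map_div₀, map_mul, map_one, map_ofNat]
    field_simp
    linear_combination 4 * hdet

/-! ### The local Weierstrass-type representation -/

theorem mainTheorem3 (D : Set ℂ) (hD : IsOpen D) (ν : ℂ → ℝ)
    (hsmooth : ContDiffOn ℝ ∞ ν D)
    (hpos : ∀ z ∈ D, 0 < ν z)
    (hreg : ∀ z ∈ D, partialX ν z * partialY ν z ≠ 0)
    (hpde : SolvesNaturalPDE D ν) :
    ∀ z₀ ∈ D, ∃ U : Set ℂ, IsOpen U ∧ z₀ ∈ U ∧ U ⊆ D ∧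
      ∃ (w : ℂ → ℂ) (u v : ℂ → ℝ), DifferentiableOn ℂ w U ∧
        (∀ z ∈ U, w z = (u z : ℂ) + Complex.I * (v z : ℂ)) ∧
        ∀ z ∈ U, ν z =
          4 * (partialX u z ^ 2 + partialY u z ^ 2) / (u z ^ 2 + v z ^ 2 + 1) ^ 2 := by
  intro z₀ hz₀
  have hlog : ContDiffOn ℝ ∞ (fun z => Real.log (ν z)) D :=
    hsmooth.log fun z hz => (hpos z hz).ne'
  set Φ : ℂ → ℂ := ofRealCLM ∘ fun z => Real.log (ν z)
  have hΦ : ContDiffOn ℝ ∞ Φ D := ofRealCLM.contDiff.comp_contDiffOn hlog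
  have hΦν : ∀ z ∈ D, exp (Φ z) = ν z := fun z hz => by
    simp only [Φ, Function.comp_apply, ofRealCLM_apply]
    rw [← ofReal_exp, Real.exp_log (hpos z hz)]
  have hL : ∀ z ∈ D, Laplacian.laplacian Φ z = -2 * exp (Φ z) := fun z hz => by
    have h2 : ContDiffAt ℝ 2 (fun z => Real.log (ν z)) z :=
      (hlog.contDiffAt (hD.mem_nhds hz)).of_le (WithTop.coe_le_coe.2 le_top : ((2 : ℕ∞) : ℕ∞ω) ≤ ∞)
    rw [h2.laplacian_CLM_comp_left, hΦν z hz, Function.comp_apply, ofRealCLM_apply,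
      eq_neg_of_add_eq_zero_left (hpde z hz)]
    push_cast; ring
  obtain ⟨q, p, s, m, hq, hsys⟩ := exists_wirtinger_system_of_liouville hD hΦ
    (fun z _ => conj_ofReal _) hL
  set g : ℂ → ℝ := fun z => Real.exp (-Real.log (ν z) / 2)
  have hg : ∀ z, exp (-Φ z / 2) = (g z : ℂ) := fun z => by
    simp only [Φ, g, Function.comp_apply, ofRealCLM_apply]; push_cast; rfl
  have hgν : ∀ z ∈ D, ν z = 1 / g z ^ 2 := fun z hz => by
    simp only [g]
    rw [← Real.exp_nat_mul, one_div, ← Real.exp_neg]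
    conv_lhs => rw [← Real.exp_log (hpos z hz)]
    congr 1; push_cast; ring
  obtain ⟨r, hr, hrD, y, x, y', x', hy0, H⟩ := exists_sum_norm_sq_representation hD hq
    (fun z hz => (hsys z hz).2.2.1) (fun z hz => (hsys z hz).2.2.2.1)
    (fun z hz => (hsys z hz).2.2.2.2.1) (fun z hz => (hsys z hz).2.2.2.2.2) hz₀
    (Real.sqrt_pos.2 (Real.exp_pos _ : 0 < g z₀))
    (by rw [Real.sq_sqrt (Real.exp_pos _).le, hg]) (hsys z₀ hz₀).1 (hsys z₀ hz₀).2.1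
  have hyc : ContinuousOn y (ball z₀ r) := fun z hz =>
    (H z hz).1.continuousAt.continuousWithinAt
  have hw : ∀ z ∈ ball z₀ r ∩ y ⁻¹' {0}ᶜ,
      HasDerivAt (fun z => x z / y z) (1 / 2 / y z ^ 2) z := fun z hz => by
    obtain ⟨h1, h2, h3, -⟩ := H z hz.1
    refine (h2.div h1 hz.2).congr_deriv ?_
    rw [← h3]; ring
  -- The zeros of y, which are poles of w, are removed; y(z₀) ≠ 0 keeps z₀ in the set.
  refine ⟨ball z₀ r ∩ y ⁻¹' {0}ᶜ, hyc.isOpen_inter_preimage isOpen_ball isOpen_compl_singleton,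
    ⟨mem_ball_self hr, hy0⟩, inter_subset_left.trans hrD, fun z => x z / y z,
    fun z => (x z / y z).re, fun z => (x z / y z).im,
    fun z hz => (hw z hz).differentiableAt.differentiableWithinAt,
    fun z _ => by rw [mul_comm, re_add_im], fun z hz => ?_⟩
  have hu : HasFDerivAt (fun z => (x z / y z).re) _ z :=
    reCLM.hasFDerivAt.comp z ((hw z hz).hasFDerivAt.restrictScalars ℝ)
  -- By the Cauchy–Riemann equations w' = u_x - i u_y.
  have hX : partialX (fun z => (x z / y z).re) z = (1 / 2 / y z ^ 2).re := by
    rw [partialX, (hu.hasLineDerivAt 1).lineDeriv]; simp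
  have hY : partialY (fun z => (x z / y z).re) z = -(1 / 2 / y z ^ 2).im := by
    rw [partialY, (hu.hasLineDerivAt I).lineDeriv]; simp
  have hgz : g z = normSq (y z) + normSq (x z) := by
    have := (H z hz.1).2.2.2
    rw [hg, mul_conj, mul_conj] at this
    exact_mod_cast this
  have hn : ∀ w : ℂ, w.re ^ 2 + w.im ^ 2 = normSq w := fun w => by rw [normSq_apply]; ring
  have hny : normSq (y z) ≠ 0 := fun h => hz.2 (normSq_eq_zero.1 h)
  have hgz0 : normSq (y z) + normSq (x z) ≠ 0 := hgz ▸ (Real.exp_pos _).ne'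
  rw [hX, hY, neg_sq, hn, hn, hgν z (hrD hz.1), hgz]
  simp only [map_div₀, map_pow, map_one]
  rw [show normSq 2 = 4 by norm_num [normSq_apply]]
  have h3 : normSq (x z) + normSq (y z) ≠ 0 := by rwa [add_comm]
  field_simp
  ring
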